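/- Let $\mathbb{Z}$ be the discrete group of integers, let $\mathbb{Z}^{\mathbb{N}}$ be the Baer–Specker group of all integer sequences, and let $G=\mathrm{Hom}(\mathbb{Z}^{\mathbb{N}},\mathbb{Z})$ be the group of all group homomorphisms $\mathbb{Z}^{\mathbb{N}}\to\mathbb{Z}$, regarded as a subgroup of the product $\mathbb{Z}^{\mathbb{Z}^{\mathbb{N}}}$ of copies of $\mathbb{Z}$ with the product topology, and given the subspace topology (that is, the topology of pointwise convergence). For an abelian topological group $A$ let $\widehat{A}$ be its Pontryagin dual, the group of all continuous homomorphisms from $A$ to the circle group with the compact-open topology; $A$ is called reflexive if $\widehat{\widehat{A}}$ is topologically isomorphic to $A$. Then: 1. $G$ is a closed subgroup of $\mathbb{Z}^{\mathbb{Z}^{\mathbb{N}}}$; 2. $G$ is, as an abstract group, a free abelian group on countably infinitely many generators; 3. $G$ is not discrete; 4. the second dual $\widehat{\widehat{G}}$ is discrete; 5. consequently, $G$ is not reflexive. -/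

import Mathlib

/-- The second Pontryagin dual of an additively written topological abelian group `A`:
the continuous characters, with values in the circle group, of the group of continuous characters
of `A`. Both groups of characters carry the compact-open topology. -/
abbrev PontryaginBidual (A : Type*) [AddCommGroup A] [TopologicalSpace A]
    [IsTopologicalAddGroup A] : Type _ :=
  PontryaginDual (PontryaginDual (Multiplicative A))

/-- A topological abelian group is reflexive if it is topologically isomorphic (by some
isomorphism of topological groups) to its second Pontryagin dual. -/
def IsReflexiveGroup (A : Type*) [AddCommGroup A] [TopologicalSpace A]
    [IsTopologicalAddGroup A] : Prop :=
  Nonempty (Multiplicative A ≃ₜ* PontryaginBidual A)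

/-- The Baer-Specker group: all sequences of integers, with pointwise addition. -/
abbrev BaerSpecker : Type := ℕ → ℤ

/-- The group of all group homomorphisms from the Baer-Specker group to `ℤ`, as a subgroup of the
group of all functions from the Baer-Specker group to `ℤ`. The latter is the product of copies of
the discrete group `ℤ` and has the product topology, so the topology induced on the subgroup is the
topology of pointwise convergence. -/
def baerSpeckerHom : AddSubgroup (BaerSpecker → ℤ) :=
  (AddMonoidHom.coeFn BaerSpecker ℤ).range

/-! By Specker's theorem a homomorphism `ℤ^ℕ → ℤ` is a finite integer combination of coordinates, so
`G` is free on the coordinates; finitely many evaluations cannot separate infinite rank, so `G` is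
not discrete.

A gliding hump gives pointwise bounded families a common finite support, so compact subsets of `G`
are finite (`IsCompact.finite_of_baerSpeckerHom`). The dual thus carries the topology induced from
`Circle^ℕ`. There the union of the coordinate circles is compact and generates a dense subgroup. A
bidual character sending it into a small arc is trivial, so the bidual is discrete and cannot be
isomorphic to `G`. -/

/-! ### Specker's theorem -/

theorem AddMonoidHom.dvd_sub_sum_single (f : (ℕ → ℤ) →+ ℤ) {x : ℕ → ℤ} {n : ℕ} {d : ℤ}
    (h : ∀ m, n ≤ m → d ∣ x m) :
    d ∣ f x - ∑ j ∈ Finset.range n, x j * f (Pi.single j 1) := by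
  choose! y hy using h
  have hx : x = ∑ j ∈ Finset.range n, x j • (Pi.single j 1 : ℕ → ℤ) +
      d • fun m => if m < n then 0 else y m := by
    ext m
    by_cases hm : m < n
    · simp [Finset.sum_apply, Pi.single_apply, hm]
    · simp [Finset.sum_apply, Pi.single_apply, hm, hy m (not_lt.1 hm)]
  refine ⟨f fun m => if m < n then 0 else y m, ?_⟩
  rw [sub_eq_iff_eq_add']
  conv_lhs => rw [hx]
  rw [map_add, map_sum, map_zsmul, smul_eq_mul]
  simp only [map_zsmul, smul_eq_mul]

theorem AddMonoidHom.apply_eq_sum_single (f : (ℕ → ℤ) →+ ℤ) {x : ℕ → ℤ} {n : ℕ}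
    (h : ∀ m, n ≤ m → x m = 0) :
    f x = ∑ j ∈ Finset.range n, x j * f (Pi.single j 1) := by
  have := f.dvd_sub_sum_single (d := 0) (x := x) (n := n) (fun m hm => by simp [h m hm])
  exact sub_eq_zero.1 (zero_dvd_iff.1 this)

/-- Every tail of `x` is divisible by `p ^ n`, hence so is `f x`; at `n = |f x|` this power exceeds
`|f x|`. -/
theorem AddMonoidHom.apply_eq_zero_of_pow_dvd {f : (ℕ → ℤ) →+ ℤ}
    (hf : ∀ n, f (Pi.single n 1) = 0) {p : ℕ} (hp : 1 < p) {x : ℕ → ℤ}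
    (hx : ∀ n, (p : ℤ) ^ n ∣ x n) : f x = 0 := by
  refine Int.eq_zero_of_abs_lt_dvd (m := (p : ℤ) ^ (f x).natAbs) ?_ ?_
  · simpa [hf] using f.dvd_sub_sum_single (x := x) (n := (f x).natAbs)
      fun m hm => (pow_dvd_pow _ hm).trans (hx m)
  · rw [Int.abs_eq_natAbs]
    exact_mod_cast Nat.lt_pow_self hp

theorem AddMonoidHom.eq_zero_of_apply_single {f : (ℕ → ℤ) →+ ℤ}
    (hf : ∀ n, f (Pi.single n 1) = 0) : f = 0 := by
  ext x
  -- By Bézout, each sequence is a sum of one divisible termwise by `2 ^ n` and one by `3 ^ n`.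
  have hc : ∀ n : ℕ, IsCoprime ((2 : ℤ) ^ n) (3 ^ n) := fun n =>
    IsCoprime.pow ⟨-1, 1, by norm_num⟩
  choose a b hab using hc
  have hx : x = (fun n => x n * a n * 2 ^ n) + fun n => x n * b n * 3 ^ n := by
    ext n
    simp only [Pi.add_apply]
    linear_combination -(x n) * hab n
  rw [hx, map_add, f.apply_eq_zero_of_pow_dvd hf (p := 2) (by norm_num) (fun n => by simp),
    f.apply_eq_zero_of_pow_dvd hf (p := 3) (by norm_num) (fun n => by simp)]
  simp

/-- The pairs `(∑ j < k, d j * c j, d k)` for a rapidly increasing divisibility chain `d`. -/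
def rapidChain (c : ℕ → ℤ) : ℕ → ℤ × ℤ
  | 0 => (0, 1)
  | k + 1 =>
    let s := (rapidChain c k).1 + (rapidChain c k).2 * c k
    (s, (rapidChain c k).2 * (|s| + k + 2))

theorem rapidChain_fst (c : ℕ → ℤ) (k : ℕ) :
    (rapidChain c k).1 = ∑ j ∈ Finset.range k, (rapidChain c j).2 * c j := by
  induction k with
  | zero => rfl
  | succ k ih => rw [Finset.sum_range_succ, ← ih]; rfl

theorem rapidChain_snd_dvd (c : ℕ → ℤ) {k m : ℕ} (h : k ≤ m) :
    (rapidChain c k).2 ∣ (rapidChain c m).2 := by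
  induction m, h using Nat.le_induction with
  | base => rfl
  | succ m _ ih => exact ih.trans (Dvd.intro _ rfl)

theorem lt_rapidChain_snd (c : ℕ → ℤ) (k : ℕ) :
    |(rapidChain c k).1| + k < (rapidChain c k).2 := by
  induction k with
  | zero => simp [rapidChain]
  | succ k ih =>
    have h1 : 1 ≤ (rapidChain c k).2 := by
      have := abs_nonneg (rapidChain c k).1
      omega
    simp only [rapidChain]
    set s := (rapidChain c k).1 + (rapidChain c k).2 * c k
    have := abs_nonneg s
    push_cast
    nlinarith

/-- Evaluate `f` at the chain `d`: modulo `d k`, `f d` is the `k`-th partial sum, and `d k` is so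
large that equality holds once `k ≥ |f d|`. Equal consecutive partial sums force `c k = 0`. -/
theorem AddMonoidHom.finite_support_single (f : (ℕ → ℤ) →+ ℤ) :
    {n | f (Pi.single n 1) ≠ 0}.Finite := by
  set c : ℕ → ℤ := fun n => f (Pi.single n 1)
  set x : ℕ → ℤ := fun n => (rapidChain c n).2
  have key : ∀ k, (f x).natAbs ≤ k → f x = (rapidChain c k).1 := by
    intro k hk
    have hd : x k ∣ f x - (rapidChain c k).1 := by
      rw [rapidChain_fst]
      exact f.dvd_sub_sum_single fun m hm => rapidChain_snd_dvd c hm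
    refine sub_eq_zero.1 (Int.eq_zero_of_abs_lt_dvd hd ?_)
    refine lt_of_le_of_lt ?_ (lt_rapidChain_snd c k)
    refine (abs_sub _ _).trans ?_
    rw [add_comm]
    rw [Int.abs_eq_natAbs (f x)]
    gcongr
  refine (Set.finite_lt_nat (f x).natAbs).subset fun n hn => ?_
  by_contra hlt
  have hle : (f x).natAbs ≤ n := not_lt.1 hlt
  have h1 := key n hle
  have h2 := key (n + 1) (hle.trans n.le_succ)
  rw [rapidChain_fst] at h1 h2
  rw [Finset.sum_range_succ, ← h1] at h2
  have h3 := lt_rapidChain_snd c n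
  have h4 := abs_nonneg (rapidChain c n).1
  have : (rapidChain c n).2 * c n = 0 := by linarith
  rcases mul_eq_zero.1 this with h | h
  · omega
  · exact hn h

theorem AddMonoidHom.apply_eq_sum_of_single_eq_zero {f : (ℕ → ℤ) →+ ℤ} {n : ℕ}
    (hf : ∀ m, n ≤ m → f (Pi.single m 1) = 0) (x : ℕ → ℤ) :
    f x = ∑ j ∈ Finset.range n, x j * f (Pi.single j 1) := by
  let g : (ℕ → ℤ) →+ ℤ :=
    ∑ j ∈ Finset.range n, (AddMonoidHom.mulRight (f (Pi.single j 1))).comp (Pi.evalAddMonoidHom _ j)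
  have hg : ∀ y, g y = ∑ j ∈ Finset.range n, y j * f (Pi.single j 1) := fun y => by
    simp [g, AddMonoidHom.finsetSum_apply]
  have : f - g = 0 := AddMonoidHom.eq_zero_of_apply_single fun m => by
    rw [AddMonoidHom.sub_apply, hg]
    by_cases hm : m < n
    · simp [Pi.single_apply, hm]
    · simp [Pi.single_apply, hm, hf m (not_lt.1 hm)]
  rw [← hg, sub_eq_zero.1 this]

/-! ### Gliding hump and uniform support -/

/-- Partial vectors of the gliding hump construction for the sequence `f`. -/
def glidingHump (f : ℕ → (ℕ → ℤ) →+ ℤ) : ℕ → ℕ → ℤ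
  | 0 => 0
  | n + 1 => glidingHump f n + Pi.single n (n + |f n (glidingHump f n)|)

theorem glidingHump_apply (f : ℕ → (ℕ → ℤ) →+ ℤ) (n m : ℕ) :
    glidingHump f n m = if m < n then m + |f m (glidingHump f m)| else 0 := by
  induction n with
  | zero => rfl
  | succ n ih =>
    simp only [glidingHump, Pi.add_apply, ih, Pi.single_apply]
    rcases lt_trichotomy m n with h | rfl | h
    · simp [h, h.ne, h.trans n.lt_succ_self]
    · simp
    · simp [h.ne', not_lt.2 h.le, not_lt.2 (Nat.succ_le_of_lt h)]

/-- The entry `x n` is large enough for the last term of `f n x` to outweigh the earlier ones by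
`n`. -/
theorem exists_forall_le_abs_apply (f : ℕ → (ℕ → ℤ) →+ ℤ) :
    ∃ x : ℕ → ℤ, ∀ n, f n (Pi.single n 1) ≠ 0 → (∀ m, n < m → f n (Pi.single m 1) = 0) →
      (n : ℤ) ≤ |f n x| := by
  refine ⟨fun n => n + |f n (glidingHump f n)|, fun n hn hm => ?_⟩
  set x : ℕ → ℤ := fun n => n + |f n (glidingHump f n)|
  have h1 : f n (glidingHump f n) = ∑ j ∈ Finset.range n, x j * f n (Pi.single j 1) := by
    rw [(f n).apply_eq_sum_single (n := n) fun m hm => by simp [glidingHump_apply, hm.not_gt]]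
    refine Finset.sum_congr rfl fun j hj => ?_
    rw [glidingHump_apply, if_pos (Finset.mem_range.1 hj)]
  rw [AddMonoidHom.apply_eq_sum_of_single_eq_zero (n := n + 1) (fun m h => hm m h),
    Finset.sum_range_succ, ← h1]
  set a := f n (glidingHump f n)
  have h2 : x n = n + |a| := rfl
  have h3 : 1 ≤ |f n (Pi.single n 1)| := Int.one_le_abs hn
  have h4 : |x n * f n (Pi.single n 1)| ≤ |a + x n * f n (Pi.single n 1)| + |a| := by
    have := abs_sub (a + x n * f n (Pi.single n 1)) a
    simpa using this
  have h5 : 0 ≤ x n := by have := abs_nonneg a; omega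
  rw [abs_mul, abs_of_nonneg h5] at h4
  nlinarith

theorem exists_forall_single_eq_zero_of_bounded {S : Set ((ℕ → ℤ) →+ ℤ)}
    (hS : ∀ x, ∃ C : ℤ, ∀ f ∈ S, |f x| ≤ C) :
    ∃ N, ∀ f ∈ S, ∀ n, N ≤ n → f (Pi.single n 1) = 0 := by
  classical
  by_contra! hcon
  let P : ℕ → ((ℕ → ℤ) →+ ℤ) → Prop := fun n f =>
    f ∈ S ∧ f (Pi.single n 1) ≠ 0 ∧ ∀ m, n < m → f (Pi.single m 1) = 0
  -- One member of `S` per last support index; the default `0` is never tested, as it vanishes on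
  -- unit vectors.
  let F : ℕ → (ℕ → ℤ) →+ ℤ := fun n => if h : ∃ f, P n f then h.choose else 0
  obtain ⟨x, hx⟩ := exists_forall_le_abs_apply F
  obtain ⟨C, hC⟩ := hS x
  obtain ⟨f, hf, n, hn, hne⟩ := hcon (C.natAbs + 1)
  obtain ⟨k, hk, hmax⟩ := Set.exists_max_image _ id f.finite_support_single ⟨n, hne⟩
  have hP : ∃ f, P k f := ⟨f, hf, hk, fun m hm => by
    by_contra h
    exact absurd (hmax m h) (not_le.2 hm)⟩
  have hF : P k (F k) := by
    simp only [F, dif_pos hP]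
    exact hP.choose_spec
  have h1 := hx k hF.2.1 hF.2.2
  have h2 := hC _ hF.1
  have h3 : n ≤ k := hmax n hne
  omega

/-! ### Algebra and topology of `G` -/

namespace baerSpeckerHom

/-- An element of `baerSpeckerHom` as a bundled homomorphism. -/
def toHom (F : baerSpeckerHom) : (ℕ → ℤ) →+ ℤ :=
  AddMonoidHom.mk' F.1 fun x y => by
    obtain ⟨f, hf⟩ := F.2
    simp [← hf]

/-- The `n`-th coordinate functional. -/
def coord (n : ℕ) : baerSpeckerHom :=
  ⟨fun x => x n, Pi.evalAddMonoidHom (fun _ => ℤ) n, rfl⟩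

@[simp]
theorem coord_apply (n : ℕ) (x : ℕ → ℤ) : (coord n).1 x = x n := rfl

theorem coe_sum_apply {ι : Type*} (s : Finset ι) (c : ι → ℤ) (φ : ι → baerSpeckerHom)
    (x : ℕ → ℤ) : (∑ j ∈ s, c j • φ j).1 x = ∑ j ∈ s, c j * (φ j).1 x := by
  simp [Finset.sum_apply]

theorem eq_sum_coord {F : baerSpeckerHom} {n : ℕ}
    (hF : ∀ m, n ≤ m → F.1 (Pi.single m 1) = 0) :
    F = ∑ j ∈ Finset.range n, F.1 (Pi.single j 1) • coord j := by
  ext x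
  rw [coe_sum_apply]
  exact (AddMonoidHom.apply_eq_sum_of_single_eq_zero (f := (toHom F)) hF x).trans
    (Finset.sum_congr rfl fun j _ => mul_comm _ _)

theorem finite_support (F : baerSpeckerHom) : {n | F.1 (Pi.single n 1) ≠ 0}.Finite :=
  (toHom F).finite_support_single

theorem exists_forall_eq_zero (F : baerSpeckerHom) :
    ∃ n, ∀ m, n ≤ m → F.1 (Pi.single m 1) = 0 := by
  obtain ⟨n, hn⟩ := (finite_support F).bddAbove
  exact ⟨n + 1, fun m hm => by_contra fun h => absurd (hn h) (not_le.2 hm)⟩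

theorem ext_single {F F' : baerSpeckerHom}
    (h : ∀ n, F.1 (Pi.single n 1) = F'.1 (Pi.single n 1)) : F = F' := by
  have : (toHom F) - (toHom F') = 0 :=
    AddMonoidHom.eq_zero_of_apply_single fun n => sub_eq_zero.2 (h n)
  exact Subtype.ext (funext fun x => DFunLike.congr_fun (sub_eq_zero.1 this) x)

/-- A homomorphism `ℤ^ℕ → ℤ` is given by its finitely many nonzero values on unit vectors. -/
noncomputable def equivFinsupp : baerSpeckerHom ≃+ (ℕ →₀ ℤ) :=
  AddEquiv.ofBijective
    (AddMonoidHom.mk' (fun F : baerSpeckerHom =>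
      Finsupp.ofSupportFinite (fun n => F.1 (Pi.single n 1)) (finite_support F)) fun F F' => by ext n; rfl)
    ⟨fun F F' h => ext_single fun n => DFunLike.congr_fun h n,
    fun c => ⟨∑ j ∈ c.support, c j • coord j, by
      ext n
      simp only [AddMonoidHom.mk'_apply, Finsupp.ofSupportFinite_coe, coe_sum_apply, coord_apply]
      simp only [Pi.single_apply]
      simpa using Eq.symm⟩⟩

theorem isClosed : IsClosed (baerSpeckerHom : Set (BaerSpecker → ℤ)) :=
  AddMonoidHom.isClosed_range_coe BaerSpecker ℤ

theorem continuous_apply (x : ℕ → ℤ) : Continuous fun F : baerSpeckerHom => F.1 x :=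
  (_root_.continuous_apply x).comp continuous_subtype_val

theorem not_discreteTopology : ¬ DiscreteTopology baerSpeckerHom := by
  intro h
  have h0 : IsOpen ({0} : Set baerSpeckerHom) := isOpen_discrete _
  obtain ⟨V, hV, hV0⟩ := isOpen_induced_iff.1 h0
  have h0V : (0 : BaerSpecker → ℤ) ∈ V := by
    have : (0 : baerSpeckerHom) ∈ Subtype.val ⁻¹' V := hV0 ▸ rfl
    exact this
  obtain ⟨I, u, hu, hsub⟩ := isOpen_pi_iff.1 hV 0 h0V
  have key : ∀ F : baerSpeckerHom, (∀ x ∈ I, F.1 x = 0) → F = 0 := fun F hF => by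
    have : F ∈ Subtype.val ⁻¹' V := hsub fun x hx => by
      rw [hF x hx]
      exact (hu x hx).2
    rwa [hV0] at this
  -- Evaluating combinations of `I.card + 1` coordinates on `I` would be injective, against the
  -- rank.
  let Φ : (Fin (I.card + 1) → ℤ) →ₗ[ℤ] I → ℤ :=
    LinearMap.pi fun x => ∑ j : Fin (I.card + 1), x.1 j • LinearMap.proj j
  have hΦ : ∀ c x, Φ c x = ∑ j : Fin (I.card + 1), c j * x.1 j := fun c x => by
    simp [Φ, LinearMap.sum_apply, mul_comm]
  have hinj : Function.Injective Φ := by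
    refine (injective_iff_map_eq_zero Φ).2 fun c hc => ?_
    have hz := key (∑ j, c j • coord (j : ℕ)) fun x hx => by
      rw [coe_sum_apply, ← show Φ c ⟨x, hx⟩ = 0 by rw [hc]; rfl, hΦ]
      rfl
    ext i
    have := congrArg (fun F : baerSpeckerHom => F.1 (Pi.single (i : ℕ) 1)) hz
    simpa [coe_sum_apply, Pi.single_apply, Fin.val_inj] using this
  have := LinearMap.finrank_le_finrank_of_injective hinj
  simp at this

/-- Compactness bounds `K` pointwise, so finitely many unit vectors determine its members; the image
in the discrete group `ℤ^N` is compact, hence finite. -/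
theorem _root_.IsCompact.finite_of_baerSpeckerHom {K : Set baerSpeckerHom} (hK : IsCompact K) :
    K.Finite := by
  obtain ⟨N, hN⟩ := exists_forall_single_eq_zero_of_bounded (S := toHom '' K) fun x => by
    obtain ⟨C, hC⟩ := hK.exists_bound_of_continuousOn (continuous_apply x).continuousOn
    refine ⟨⌈C⌉, ?_⟩
    rintro _ ⟨F, hF, rfl⟩
    have := hC F hF
    rw [Int.norm_eq_abs] at this
    exact_mod_cast this.trans (Int.le_ceil C)
  have hN' : ∀ F ∈ K, ∀ n, N ≤ n → F.1 (Pi.single n 1) = 0 := fun F hF =>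
    hN _ ⟨F, hF, rfl⟩
  refine Set.Finite.of_finite_image (f := fun F (j : Fin N) => F.1 (Pi.single (j : ℕ) 1))
    ((hK.image (by exact continuous_pi fun j => continuous_apply _)).finite_of_discrete) ?_
  intro F hF F' hF' h
  refine ext_single fun n => ?_
  by_cases hn : n < N
  · exact congrFun h ⟨n, hn⟩
  · rw [hN' F hF n (not_lt.1 hn), hN' F' hF' n (not_lt.1 hn)]

/-! ### The dual and the bidual -/

/-- The values of a character on the coordinate functionals. -/
noncomputable def dualCoord (χ : PontryaginDual (Multiplicative baerSpeckerHom)) (n : ℕ) : Circle :=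
  χ (.ofAdd (coord n))

theorem dual_apply {F : baerSpeckerHom} {n : ℕ}
    (hF : ∀ m, n ≤ m → F.1 (Pi.single m 1) = 0)
    (χ : PontryaginDual (Multiplicative baerSpeckerHom)) :
    χ (.ofAdd F) = ∏ j ∈ Finset.range n, dualCoord χ j ^ F.1 (Pi.single j 1) := by
  conv_lhs => rw [eq_sum_coord hF]
  simp [ofAdd_sum, ofAdd_zsmul, map_prod, map_zpow, dualCoord]

theorem continuous_dual_apply (F : Multiplicative baerSpeckerHom) :
    Continuous fun χ : PontryaginDual (Multiplicative baerSpeckerHom) => χ F :=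
  (inferInstance : ContinuousEvalConst (Multiplicative baerSpeckerHom →ₜ* Circle) _ _)
    |>.continuous_eval_const F

/-- As compact sets are finite, the compact-open topology is pointwise convergence, and each `χ F`
is a finite product of powers of coordinates. -/
theorem isInducing_dualCoord : Topology.IsInducing dualCoord := by
  refine ⟨le_antisymm ?_ ?_⟩
  · exact (continuous_pi fun n => continuous_dual_apply _).le_induced
  · let _ : TopologicalSpace (PontryaginDual (Multiplicative baerSpeckerHom)) :=
      .induced dualCoord inferInstance
    have hc : ∀ n, Continuous fun χ => dualCoord χ n := continuous_pi_iff.1 continuous_induced_dom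
    refine continuous_iff_le_induced.1 (ContinuousMap.continuous_compactOpen.2 fun K hK U hU => ?_)
    have hfin : K.Finite := IsCompact.finite_of_baerSpeckerHom (K := K) hK
    have : {χ : PontryaginDual (Multiplicative baerSpeckerHom) | Set.MapsTo χ K U} =
        ⋂ F ∈ K, {χ | χ F ∈ U} := by
      ext χ
      simp [Set.MapsTo]
    change IsOpen {χ : PontryaginDual (Multiplicative baerSpeckerHom) | Set.MapsTo χ K U}
    rw [this]
    refine hfin.isOpen_biInter fun F _ => ?_
    obtain ⟨n, hn⟩ := exists_forall_eq_zero F.toAdd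
    refine hU.preimage ?_
    change Continuous fun χ : PontryaginDual (Multiplicative baerSpeckerHom) => χ (.ofAdd F.toAdd)
    simp only [dual_apply hn]
    exact continuous_finsetProd _ fun j _ => (hc j).zpow _

/-- The character `F ↦ t ^ F(eₙ)`. -/
noncomputable def singleChar (n : ℕ) : Circle →* PontryaginDual (Multiplicative baerSpeckerHom) where
  toFun t :=
    ({ toFun := fun F => t ^ F.toAdd.1 (Pi.single n 1)
       map_one' := by simp
       map_mul' := fun F F' => by simp [zpow_add]
       continuous_toFun :=
        (continuous_of_discreteTopology (f := fun k : ℤ => t ^ k)).comp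
          (continuous_apply (Pi.single n 1)) } : Multiplicative baerSpeckerHom →ₜ* Circle)
  map_one' := PontryaginDual.ext fun F => one_zpow _
  map_mul' s t := PontryaginDual.ext fun F => mul_zpow s t _

theorem singleChar_apply (n : ℕ) (t : Circle) (F : Multiplicative baerSpeckerHom) :
    singleChar n t F = t ^ F.toAdd.1 (Pi.single n 1) := rfl

theorem dualCoord_singleChar (n : ℕ) (t : Circle) (m : ℕ) :
    dualCoord (singleChar n t) m = if m = n then t else 1 := by
  simp only [dualCoord, singleChar_apply, toAdd_ofAdd, coord_apply, Pi.single_apply]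
  split_ifs <;> simp

/-- In `Circle^ℕ` this is the set of sequences with at most one nontrivial entry, closed in a
compact space. -/
theorem isCompact_range_singleChar :
    IsCompact (Set.range fun p : ℕ × Circle => singleChar p.1 p.2) := by
  rw [isInducing_dualCoord.isCompact_iff]
  have : dualCoord '' (Set.range fun p : ℕ × Circle => singleChar p.1 p.2) =
      ⋂ m, ⋂ n, {z : ℕ → Circle | m = n ∨ z m = 1 ∨ z n = 1} := by
    ext z
    simp only [Set.mem_image, Set.mem_range, Prod.exists, exists_exists_exists_and_eq,
      Set.mem_iInter, Set.mem_ofPred_eq]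
    constructor
    · rintro ⟨k, t, rfl⟩ m n
      simp only [dualCoord_singleChar]
      grind
    · intro h
      by_cases hz : ∃ k, z k ≠ 1
      · obtain ⟨k, hk⟩ := hz
        refine ⟨k, z k, funext fun m => ?_⟩
        rw [dualCoord_singleChar]
        have := h m k
        grind
      · push Not at hz
        exact ⟨0, 1, funext fun m => by rw [dualCoord_singleChar]; simp [hz]⟩
  rw [this]
  refine IsClosed.isCompact (isClosed_iInter fun m => isClosed_iInter fun n => ?_)
  by_cases hmn : m = n
  · simp [hmn]
  · simp only [hmn, false_or]
    exact (isClosed_eq (_root_.continuous_apply m) continuous_const).union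
      (isClosed_eq (_root_.continuous_apply n) continuous_const)

theorem tendsto_prod_singleChar (χ : PontryaginDual (Multiplicative baerSpeckerHom)) :
    Filter.Tendsto (fun n => ∏ j ∈ Finset.range n, singleChar j (dualCoord χ j))
      Filter.atTop (nhds χ) := by
  rw [isInducing_dualCoord.tendsto_nhds_iff, tendsto_pi_nhds]
  intro m
  refine tendsto_const_nhds.congr' ?_
  filter_upwards [Filter.eventually_gt_atTop m] with n hn
  let ev : PontryaginDual (Multiplicative baerSpeckerHom) →* Circle :=
    { toFun := fun χ => dualCoord χ m
      map_one' := rfl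
      map_mul' := fun _ _ => rfl }
  change _ = ev _
  rw [map_prod]
  change _ = ∏ j ∈ Finset.range n, dualCoord (singleChar j (dualCoord χ j)) m
  simp only [dualCoord_singleChar]
  simp [hn]

theorem bidual_eq_one {ξ : PontryaginBidual baerSpeckerHom}
    (h : ∀ n t, ξ (singleChar n t) = 1) : ξ = 1 := by
  ext1 χ
  have h1 := ((map_continuous ξ).tendsto χ).comp (tendsto_prod_singleChar χ)
  have h2 : (ξ ∘ fun n => ∏ j ∈ Finset.range n, singleChar j (dualCoord χ j)) = fun _ => 1 := by
    funext n
    simp [map_prod, h]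
  rw [h2] at h1
  exact tendsto_nhds_unique h1 tendsto_const_nhds

theorem discreteTopology_bidual : DiscreteTopology (PontryaginBidual baerSpeckerHom) := by
  let K := Set.range fun p : ℕ × Circle => singleChar p.1 p.2
  let V : Set (PontryaginBidual baerSpeckerHom) :=
    {ξ | Set.MapsTo ξ K (Circle.centeredArc (Real.pi / 2))}
  have hV : IsOpen V := isOpen_induced (ContinuousMap.isOpen_setOfPred_mapsTo
    isCompact_range_singleChar (Circle.isOpen_centeredArc (Real.pi / 2)))
  have hV1 : V = {1} := by
    ext ξ
    rw [Set.mem_singleton_iff]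
    refine ⟨fun hξ => bidual_eq_one fun n t => ?_, ?_⟩
    -- `K` is stable under powers, and only `1` has all its powers in this arc.
    · refine Circle.eq_one_of_forall_pow_mem_centeredArc_pi_div_two fun k _ => ?_
      rw [← map_pow, ← map_pow]
      exact hξ ⟨(n, t ^ k), rfl⟩
    · rintro rfl _ _
      rw [Circle.mem_centeredArc (by linarith [Real.pi_pos])]
      simp [Real.pi_pos]
  exact discreteTopology_of_isOpen_singleton_one (hV1 ▸ hV)

end baerSpeckerHom

theorem corollary3p3 :
    IsClosed (baerSpeckerHom : Set (BaerSpecker → ℤ)) ∧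
    Nonempty (baerSpeckerHom ≃+ FreeAbelianGroup ℕ) ∧
    ¬ DiscreteTopology baerSpeckerHom ∧
    DiscreteTopology (PontryaginBidual baerSpeckerHom) ∧
    ¬ IsReflexiveGroup baerSpeckerHom := by
  refine ⟨baerSpeckerHom.isClosed,
    ⟨baerSpeckerHom.equivFinsupp.trans (FreeAbelianGroup.equivFinsupp ℕ).symm⟩,
    baerSpeckerHom.not_discreteTopology, baerSpeckerHom.discreteTopology_bidual, ?_⟩
  rintro ⟨e⟩
  have := baerSpeckerHom.discreteTopology_bidual
  have hd : DiscreteTopology (Multiplicative baerSpeckerHom) :=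
    e.toHomeomorph.symm.discreteTopology
  exact baerSpeckerHom.not_discreteTopology hd
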